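/- Write $\mathfrak M^+(0,\infty)$ for the set of all non-negative measurable functions on $(0,\infty)$. A weight is a function $v\in\mathfrak M^+(0,\infty)$ with $0<\int_0^x v<\infty$ for all $x\in(0,\infty)$. The convention $0\cdot\infty=0$ is used. For $1\le p<\infty$, a weight $v$ and $0\le x<y<\infty$ put $$\sigma_p(x,y)=\Big(\int_x^y v^{1-p'}\Big)^{1/p'}\ (1<p<\infty,\ p'=\tfrac{p}{p-1}),\qquad \sigma_1(x,y)=\operatorname*{ess\,sup}_{x<t<y}v(t)^{-1}.$$ Let $u$ be a weight. A covering sequence for $u$ is a strictly increasing sequence $\{x_k\}_{k\in\mathcal Z}\subset(0,\infty)$ with $\int_0^{x_k}u=2^k$ for all $k\in\mathcal Z$, where $\mathcal Z=\mathbb Z$ if $\int_0^\infty u=\infty$, and $\mathcal Z=\{k\in\mathbb Z:k\le M\}$ for an integer $M$ with $2^M\le\int_0^\infty u\le 2^{M+1}$ if $\int_0^\infty u<\infty$; in the second case put $x_{M+1}=\infty$. **Lemma.** Let $1\le p<\infty$ and $0<q,r<\infty$. In each of the cases (i)–(iv) below there is a finite constant $K$, depending only on $p,q,r$, such that for all weights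 $u,v,w$ on $(0,\infty)$ and every covering sequence $\{x_k\}_{k\in\mathcal Z}$ for $u$: if the quantity $B_i$ of that case is finite, then the inequality $$\bigg\|\bigg\{2^{k/r}\bigg(\int_{x_k}^{x_{k+1}}\bigg(\int_{x_k}^t h\bigg)^q w(t)\,dt\bigg)^{1/q}\bigg\}\bigg\|_{\ell^r(\mathcal Z)}\le C\,\bigg\|\bigg\{\bigg(\int_{x_n}^{x_{n+1}}h^pv\bigg)^{1/p}\bigg\}\bigg\|_{\ell^p(\mathcal Z)},\qquad h\in\mathfrak M^+(0,\infty),$$ holds with a finite constant $C$ independent of $h$, and the best such constant $C$ satisfies $C\le K B_i$. (i) $p\le\min\{q,r\}$, with $$B_1=\sup_{t\in(0,\infty)}\Big(\int_0^t u\Big)^{1/r}\Big(\int_t^\infty w\Big)^{1/q}\sigma_p(0,t).$$ (ii) $r<p\le q$, with $$B_2=\bigg(\int_0^\infty\Big(\int_0^t u\Big)^{\frac r{p-r}}u(t)\bigg(\operatorname*{ess\,sup}_{x\in(t,\infty)}\Big(\int_x^\infty w\Big)^{1/q}\sigma_p(0,x)\bigg)^{\frac{pr}{p-r}}dt\bigg)^{\frac{p-r}{pr}}.$$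 (iii) $q<p\le r$, with $$B_3=\sup_{t\in(0,\infty)}\Big(\int_0^t u\Big)^{1/r}\bigg(\int_t^\infty\Big(\int_x^\infty w\Big)^{\frac q{p-q}}w(x)\,[\sigma_p(0,x)]^{\frac{pq}{p-q}}\,dx\bigg)^{\frac{p-q}{pq}}.$$ (iv) $\max\{q,r\}<p$, with $$B_4=\bigg(\int_0^\infty\Big(\int_0^t u\Big)^{\frac r{p-r}}u(t)\bigg(\int_t^\infty\Big(\int_x^\infty w\Big)^{\frac q{p-q}}w(x)\,[\sigma_p(0,x)]^{\frac{pq}{p-q}}\,dx\bigg)^{\frac{r(p-q)}{q(p-r)}}dt\bigg)^{\frac{p-r}{pr}}.$$ -/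

import Mathlib

open MeasureTheory Set
open scoped ENNReal NNReal

noncomputable section

namespace CopsonHardy

/-- The class `𝔐⁺(0,∞)` of non-negative (Lebesgue) measurable functions on `(0,∞)`. A function is
represented by any extension to `ℝ`; only its values on `(0,∞)` matter. The value `∞` is allowed.
For `[0,∞]`-valued functions, a.e.-measurability with respect to Lebesgue measure (on the Borel
sets) is the same as Lebesgue measurability. -/
def MeasPos (f : ℝ → ℝ≥0∞) : Prop :=
  AEMeasurable f (volume.restrict (Ioi 0))

/-- Weights on `(0,∞)`: `v ∈ 𝔐⁺(0,∞)` with `0 < ∫₀ˣ v < ∞` for all `x ∈ (0,∞)`. -/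
structure IsWeight (v : ℝ → ℝ≥0∞) : Prop where
  meas : MeasPos v
  pos : ∀ x : ℝ, 0 < x → 0 < ∫⁻ t in Ioo 0 x, v t
  finite : ∀ x : ℝ, 0 < x → ∫⁻ t in Ioo 0 x, v t < ∞

/-- `σ_p(x,y) = (∫ₓʸ v^{1-p'})^{1/p'}` with `p' = p/(p-1)` if `1 < p < ∞`, and
`σ_1(x,y) = ess sup_{x<t<y} v(t)⁻¹`. -/
def sigma (p : ℝ) (v : ℝ → ℝ≥0∞) (x y : ℝ) : ℝ≥0∞ :=
  if p = 1 then essSup (fun t => (v t)⁻¹) (volume.restrict (Ioo x y))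
  else (∫⁻ t in Ioo x y, v t ^ (1 - p / (p - 1))) ^ (1 / (p / (p - 1)))

/-- The index set `{k ∈ ℤ : k ≤ M}`, which is all of `ℤ` when `M = ∞`. -/
def indexSet (M : WithTop ℤ) : Set ℤ := {k | (k : WithTop ℤ) ≤ M}

/-- `{x_k}_{k ≤ M}` is a covering sequence for `u`: a strictly increasing sequence of points of
`(0,∞)` with `∫₀^{x_k} u = 2^k` for all `k ≤ M`, where `M = ∞` if `∫₀^∞ u = ∞`, and `M` is an
integer with `2^M ≤ ∫₀^∞ u ≤ 2^(M+1)` if `∫₀^∞ u < ∞`. Values `x k` with `k > M` are irrelevant.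
(The upper bound is not strict, so that a covering sequence also exists when `∫₀^∞ u` is a power
of `2` that is not attained as `∫₀^x u` at any finite `x`.) -/
structure IsCoveringSequence (u : ℝ → ℝ≥0∞) (M : WithTop ℤ) (x : ℤ → ℝ) : Prop where
  pos : ∀ k ∈ indexSet M, 0 < x k
  strictMonoOn : StrictMonoOn x (indexSet M)
  integral_eq : ∀ k ∈ indexSet M, ∫⁻ t in Ioo 0 (x k), u t = (2 : ℝ≥0∞) ^ k
  total_eq_top : M = ⊤ → ∫⁻ t in Ioi 0, u t = ∞
  le_total : ∀ m : ℤ, M = (m : WithTop ℤ) → (2 : ℝ≥0∞) ^ m ≤ ∫⁻ t in Ioi 0, u t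
  total_le : ∀ m : ℤ, M = (m : WithTop ℤ) → ∫⁻ t in Ioi 0, u t ≤ (2 : ℝ≥0∞) ^ (m + 1)

/-- The interval `(x_k, x_{k+1})` for `k ≤ M`, where `x_{M+1} = ∞` if `M` is finite. -/
def cell (M : WithTop ℤ) (x : ℤ → ℝ) (k : ℤ) : Set ℝ :=
  {t | x k < t ∧ ((k : WithTop ℤ) < M → t < x (k + 1))}

/-- The `ℓ^s` (quasi-)norm of a non-negative sequence over the index set `Z`, `0 < s < ∞`. -/
def lNorm (Z : Set ℤ) (s : ℝ) (a : ℤ → ℝ≥0∞) : ℝ≥0∞ :=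
  (∑' k : Z, a k ^ s) ^ (1 / s)

/-- The discretized inequality with constant `C`: for all `h ∈ 𝔐⁺(0,∞)`,
`‖{2^{k/r} (∫_{x_k}^{x_{k+1}} (∫_{x_k}^t h)^q w(t) dt)^{1/q}}‖_{ℓ^r}
  ≤ C ‖{(∫_{x_n}^{x_{n+1}} h^p v)^{1/p}}‖_{ℓ^p}`. -/
def DiscreteIneq (p q r : ℝ) (v w : ℝ → ℝ≥0∞) (M : WithTop ℤ) (x : ℤ → ℝ) (C : ℝ≥0) : Prop :=
  ∀ h : ℝ → ℝ≥0∞, MeasPos h →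
    lNorm (indexSet M) r (fun k => (2 : ℝ≥0∞) ^ ((k : ℝ) / r) *
        (∫⁻ t in cell M x k, (∫⁻ s in Ioo (x k) t, h s) ^ q * w t) ^ (1 / q))
      ≤ C * lNorm (indexSet M) p (fun n => (∫⁻ t in cell M x n, h t ^ p * v t) ^ (1 / p))

/-- The best (least) constant in the discretized inequality; it is `∞` if the inequality holds
with no finite constant. -/
def bestConst (p q r : ℝ) (v w : ℝ → ℝ≥0∞) (M : WithTop ℤ) (x : ℤ → ℝ) : ℝ≥0∞ :=
  ⨅ (C : ℝ≥0) (_ : DiscreteIneq p q r v w M x C), (C : ℝ≥0∞)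

def B₁ (p q r : ℝ) (u v w : ℝ → ℝ≥0∞) : ℝ≥0∞ :=
  ⨆ t ∈ Ioi (0 : ℝ), (∫⁻ s in Ioo 0 t, u s) ^ (1 / r) * (∫⁻ s in Ioi t, w s) ^ (1 / q) *
    sigma p v 0 t

def B₂ (p q r : ℝ) (u v w : ℝ → ℝ≥0∞) : ℝ≥0∞ :=
  (∫⁻ t in Ioi 0, (∫⁻ s in Ioo 0 t, u s) ^ (r / (p - r)) * u t *
    (essSup (fun x => (∫⁻ s in Ioi x, w s) ^ (1 / q) * sigma p v 0 x)
      (volume.restrict (Ioi t))) ^ (p * r / (p - r))) ^ ((p - r) / (p * r))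

/-- The inner integral
`∫_t^∞ (∫_x^∞ w)^{q/(p-q)} w(x) σ_p(0,x)^{pq/(p-q)} dx` of `B₃` and `B₄`. -/
def innerInt (p q : ℝ) (v w : ℝ → ℝ≥0∞) (t : ℝ) : ℝ≥0∞ :=
  ∫⁻ x in Ioi t, (∫⁻ s in Ioi x, w s) ^ (q / (p - q)) * w x *
    sigma p v 0 x ^ (p * q / (p - q))

def B₃ (p q r : ℝ) (u v w : ℝ → ℝ≥0∞) : ℝ≥0∞ :=
  ⨆ t ∈ Ioi (0 : ℝ), (∫⁻ s in Ioo 0 t, u s) ^ (1 / r) *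
    innerInt p q v w t ^ ((p - q) / (p * q))

def B₄ (p q r : ℝ) (u v w : ℝ → ℝ≥0∞) : ℝ≥0∞ :=
  (∫⁻ t in Ioi 0, (∫⁻ s in Ioo 0 t, u s) ^ (r / (p - r)) * u t *
    innerInt p q v w t ^ (r * (p - q) / (q * (p - r)))) ^ ((p - r) / (p * r))

/-- "Finiteness of `B` suffices, with `C ≲ B`": there is a finite constant `K`, independent of the
weights and the covering sequence, such that whenever `B u v w < ∞`, the discretized inequality
holds with some finite constant, and the best constant in it is at most `K * B u v w`. -/
def Suffices (p q r : ℝ)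
    (B : (ℝ → ℝ≥0∞) → (ℝ → ℝ≥0∞) → (ℝ → ℝ≥0∞) → ℝ≥0∞) : Prop :=
  ∃ K : ℝ≥0, ∀ u v w : ℝ → ℝ≥0∞, IsWeight u → IsWeight v → IsWeight w →
    ∀ (M : WithTop ℤ) (x : ℤ → ℝ), IsCoveringSequence u M x →
      B u v w < ∞ →
        (∃ C : ℝ≥0, DiscreteIneq p q r v w M x C) ∧
          bestConst p q r v w M x ≤ K * B u v w

end CopsonHardy

end

/-!
The primitive on the left-hand side starts afresh at each `x_k`, so the inequality decouples into
Hardy inequalities on the single cells `(x_k, x_{k+1})`, with constants `A_k`. What remains is to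
bound the multiplier `{2^{k/r} A_k}` from `ℓ^p` to `ℓ^r`: by its supremum if `p ≤ r`
(`tsum_mul_rpow_le_of_le`) and, by Hölder's inequality, by its `ℓ^{pr/(p-r)}`-norm if `r < p`
(`tsum_mul_rpow_le_mul`).

Both Hardy inequalities (`hardy_of_le` for `p ≤ q` and `hardy_of_lt` for `q < p`) come from one
discretization, which also covers `p = 1` and `q < 1`. A cell is cut into the blocks
`E_k = {2^k < H ≤ 2^{k+1}}` of the primitive `H` of `h`. On `E_k` the primitive is at most `8` times
the integral of `h` over `E_{k-2}`, which is at most `σ_p(0, y_k) g_k`, where `y_k` lies between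
these two blocks and `g_k` is the `L^p(v)`-norm of `h` on `E_{k-2}`. Hence the left-hand side is
at most `8` times the `ℓ^q`-norm of `w(E_k)^{1/q} σ_p(0, y_k) g_k`
(`lintegral_primitive_rpow_mul_le`). The same two multiplier estimates, now from `ℓ^p` to `ℓ^q`,
finish the proof: for `q < p` the power `w(E_k)^{p/(p-q)}` is turned into an integral of a power of
the tail of `w` by `rpow_lintegral_le_lintegral_tail`.

Finally, `2^k = ∫₀^{x_k} u`. If `p ≤ r`, this gives `2^{k/r} A_k ≤ B` directly. If `r < p`, then
`A_k` is a power of a nonincreasing function `φ` at `x_k`, and the sum over `k` is compared with the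
integral of `U^{r/(p-r)} u φ`, `U` being the primitive of `u`, over the preceding cells
(`tsum_two_rpow_mul_le`).
-/

namespace CopsonHardy

/-! ### Multipliers between sequence spaces -/

theorem tsum_rpow_le_rpow_tsum {ι : Type*} (g : ι → ℝ≥0∞) {θ : ℝ} (hθ : 1 ≤ θ) :
    ∑' k, g k ^ θ ≤ (∑' k, g k) ^ θ := by
  have split : ∀ y : ℝ≥0∞, y ^ θ = y * y ^ (θ - 1) := fun y => by
    have := ENNReal.rpow_add_of_nonneg (x := y) 1 (θ - 1) (by norm_num) (by linarith)
    rwa [ENNReal.rpow_one, add_sub_cancel] at this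
  rw [split, ← ENNReal.tsum_mul_right]
  refine ENNReal.tsum_le_tsum fun k => ?_
  rw [split]
  have := ENNReal.le_tsum (f := g) k
  exact mul_le_mul_right (ENNReal.rpow_le_rpow this (by linarith)) _

/-- A bounded multiplier maps `ℓ^p` into `ℓ^r` when `p ≤ r`. -/
theorem tsum_mul_rpow_le_of_le {ι : Type*} (b a : ι → ℝ≥0∞) {p r : ℝ} (hp : 0 < p) (hpr : p ≤ r)
    {B : ℝ≥0∞} (hB : ∀ k, b k ≤ B) :
    (∑' k, (b k * a k) ^ r) ^ (1 / r) ≤ B * (∑' k, a k ^ p) ^ (1 / p) := by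
  have hr : 0 < r := hp.trans_le hpr
  have key : ∑' k, (b k * a k) ^ r ≤ (B * (∑' k, a k ^ p) ^ (1 / p)) ^ r := by
    calc ∑' k, (b k * a k) ^ r ≤ ∑' k, B ^ r * (a k ^ p) ^ (r / p) := by
          refine ENNReal.tsum_le_tsum fun k => ?_
          rw [ENNReal.mul_rpow_of_nonneg _ _ hr.le, ← ENNReal.rpow_mul, mul_div_cancel₀ _ hp.ne']
          gcongr
          exact hB k
      _ = B ^ r * ∑' k, (a k ^ p) ^ (r / p) := ENNReal.tsum_mul_left
      _ ≤ B ^ r * (∑' k, a k ^ p) ^ (r / p) := by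
          gcongr
          exact tsum_rpow_le_rpow_tsum _ ((one_le_div hp).2 hpr)
      _ = _ := by
          rw [ENNReal.mul_rpow_of_nonneg _ _ hr.le, ← ENNReal.rpow_mul, one_div_mul_eq_div]
  rw [one_div, ENNReal.rpow_inv_le_iff hr]
  exact key

/-- Hölder's inequality for `r < p`: a multiplier in `ℓ^{pr/(p-r)}` maps `ℓ^p` into `ℓ^r`. -/
theorem tsum_mul_rpow_le_mul {ι : Type*} (b a : ι → ℝ≥0∞) {p r : ℝ} (hr : 0 < r) (hrp : r < p) :
    (∑' k, (b k * a k) ^ r) ^ (1 / r) ≤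
      (∑' k, b k ^ (p * r / (p - r))) ^ ((p - r) / (p * r)) * (∑' k, a k ^ p) ^ (1 / p) := by
  have hp : 0 < p := hr.trans hrp
  have hd : 0 < p - r := sub_pos.2 hrp
  have hc : (p / (p - r)).HolderConjugate (p / r) := by
    rw [Real.holderConjugate_iff]
    refine ⟨(one_lt_div hd).2 (by linarith), ?_⟩
    field_simp
    ring
  let _ : MeasurableSpace ι := ⊤
  have key := ENNReal.lintegral_mul_le_Lp_mul_Lq (Measure.count : Measure ι) hc
    (f := fun k => b k ^ r) (g := fun k => a k ^ r)
    (measurable_from_top.aemeasurable) (measurable_from_top.aemeasurable)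
  have e1 : ∀ k, b k ^ (r * (p / (p - r))) = b k ^ (p * r / (p - r)) := fun k => by
    congr 1; ring
  have e2 : ∀ k, a k ^ (r * (p / r)) = a k ^ p := fun k => by
    congr 1; field_simp
  simp only [lintegral_count, Pi.mul_apply, ← ENNReal.rpow_mul, e1, e2] at key
  rw [one_div, ENNReal.rpow_inv_le_iff hr, ENNReal.mul_rpow_of_nonneg _ _ hr.le,
    ← ENNReal.rpow_mul, ← ENNReal.rpow_mul]
  simp only [ENNReal.mul_rpow_of_nonneg _ _ hr.le]
  convert key using 3
  · field_simp
  · field_simp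

/-! ### Tails, the function `σ_p` and levels of primitives -/

/-- A substitute, up to the constant, for the identity
`m ^ (1 + α) = (1 + α) ∫ (∫_{t > x} f) ^ α f(x) dx`, where `m = ∫ f`. The points at which the tail
of `f` is at least `m / 2` carry at least half of `m`. The mass `m` may be infinite, as long as it
is finite on every left half-line; then every tail is infinite. -/
theorem rpow_lintegral_le_lintegral_tail {μ : Measure ℝ} [NullSingletonClass μ]
    (f : ℝ → ℝ≥0∞) {α : ℝ} (hα : 0 ≤ α) (hf : ∀ x, ∫⁻ t in Iic x, f t ∂μ ≠ ∞) :
    (∫⁻ t, f t ∂μ) ^ (1 + α) ≤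
      2 ^ (1 + α) * ∫⁻ x, (∫⁻ t in Ioi x, f t ∂μ) ^ α * f x ∂μ := by
  set m := ∫⁻ t, f t ∂μ with hm
  have hsplit : ∀ x, m ≤ ∫⁻ t in Iic x, f t ∂μ + ∫⁻ t in Ioi x, f t ∂μ := fun x => by
    rw [hm, ← setLIntegral_univ, ← Iic_union_Ioi (a := x)]
    exact lintegral_union_le _ _ _
  have key : ∀ S : Set ℝ, MeasurableSet S → (∀ x ∈ S, m / 2 ≤ ∫⁻ t in Ioi x, f t ∂μ) →
      m / 2 ≤ ∫⁻ t in S, f t ∂μ →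
      m ^ (1 + α) ≤ 2 ^ (1 + α) * ∫⁻ x, (∫⁻ t in Ioi x, f t ∂μ) ^ α * f x ∂μ := by
    intro S hS hS1 hS2
    calc m ^ (1 + α) = 2 ^ (1 + α) * (m / 2) ^ (1 + α) := by
          rw [← ENNReal.mul_rpow_of_nonneg _ _ (by linarith),
            ENNReal.mul_div_cancel (by norm_num) (by norm_num)]
      _ = 2 ^ (1 + α) * ((m / 2) ^ α * (m / 2)) := by
          congr 1
          rw [add_comm 1 α, ENNReal.rpow_add_of_nonneg _ _ hα zero_le_one, ENNReal.rpow_one]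
      _ ≤ 2 ^ (1 + α) * ((m / 2) ^ α * ∫⁻ t in S, f t ∂μ) := by gcongr
      _ ≤ 2 ^ (1 + α) * ∫⁻ t in S, (m / 2) ^ α * f t ∂μ := by
          gcongr
          exact lintegral_const_mul_le _ _
      _ ≤ 2 ^ (1 + α) * ∫⁻ t in S, (∫⁻ t in Ioi t, f t ∂μ) ^ α * f t ∂μ := by
          gcongr 2 ^ (1 + α) * ?_
          refine setLIntegral_mono' hS fun x hx => ?_
          gcongr
          exact hS1 x hx
      _ ≤ _ := by
          gcongr
          exact Measure.restrict_le_self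
  by_cases hmt : m = ∞
  · refine key univ MeasurableSet.univ (fun x _ => ?_) (by simp [← hm, ENNReal.half_le_self])
    have := hsplit x
    rw [hmt, top_le_iff, ENNReal.add_eq_top] at this
    rw [this.resolve_left (hf x)]
    exact le_top
  -- `T` is the set where the tail is below `m / 2`, so the mass of `T` is at most `m / 2`.
  · set T := {x | ∫⁻ t in Ioi x, f t ∂μ < m / 2} with hT
    have hup : IsUpperSet T := fun x y hxy hx =>
      (lintegral_mono_set (Ioi_subset_Ioi hxy)).trans_lt hx
    have hTm : MeasurableSet T := hup.ordConnected.measurableSet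
    refine key Tᶜ hTm.compl (fun x hx => not_lt.1 hx) ?_
    have hTle : ∫⁻ t in T, f t ∂μ ≤ m / 2 := by
      obtain ⟨S, hSc, hSU⟩ := TopologicalSpace.isOpen_iUnion_countable
        (fun x : T => Ioi (x : ℝ)) (fun _ => isOpen_Ioi)
      have hsub : T ⊆ (T \ ⋃ x : T, Ioi (x : ℝ)) ∪ ⋃ x : T, Ioi (x : ℝ) := by
        intro x hx
        by_cases h : x ∈ ⋃ x : T, Ioi (x : ℝ)
        · exact Or.inr h
        · exact Or.inl ⟨hx, h⟩
      -- `T` has at most one point outside the open union: its minimum.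
      have hss : (T \ ⋃ x : T, Ioi (x : ℝ)).Subsingleton := by
        rintro x ⟨hx, hx'⟩ y ⟨hy, hy'⟩
        simp only [mem_iUnion, mem_Ioi, Subtype.exists, not_exists, not_lt] at hx' hy'
        exact le_antisymm (hx' y hy) (hy' x hx)
      calc ∫⁻ t in T, f t ∂μ
          ≤ ∫⁻ t in (T \ ⋃ x : T, Ioi (x : ℝ)), f t ∂μ
            + ∫⁻ t in ⋃ x : T, Ioi (x : ℝ), f t ∂μ :=
            (lintegral_mono_set hsub).trans (lintegral_union_le _ _ _)
        _ = ∫⁻ t in ⋃ x : T, Ioi (x : ℝ), f t ∂μ := by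
            rw [setLIntegral_measure_zero _ _ (hss.measure_zero μ), zero_add]
        _ ≤ m / 2 := by
            rw [← hSU, biUnion_eq_iUnion]
            have : Countable S := hSc
            rw [setLIntegral_iUnion_of_directed]
            · exact iSup_le fun x => le_of_lt x.1.2
            · intro x y
              rcases le_total (x.1 : ℝ) y.1 with h | h
              · exact ⟨x, Subset.rfl, Ioi_subset_Ioi h⟩
              · exact ⟨y, Ioi_subset_Ioi h, Subset.rfl⟩
    have hadd := lintegral_add_compl f hTm (μ := μ)
    have h2 : m / 2 ≠ ∞ := (ENNReal.half_le_self.trans_lt (lt_top_iff_ne_top.2 hmt)).ne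
    refine (ENNReal.add_le_add_iff_left h2).1 ?_
    calc m / 2 + m / 2 = m := ENNReal.add_halves m
      _ = ∫⁻ t in T, f t ∂μ + ∫⁻ t in Tᶜ, f t ∂μ := hadd.symm
      _ ≤ m / 2 + ∫⁻ t in Tᶜ, f t ∂μ := by gcongr

theorem sigma_mono_right (p : ℝ) (hp : 1 ≤ p) (v : ℝ → ℝ≥0∞) (a : ℝ) :
    Monotone (sigma p v a) := by
  intro x y hxy
  unfold sigma
  split_ifs with h
  · exact essSup_mono_measure
      (Measure.restrict_mono (Ioo_subset_Ioo_right hxy) le_rfl).absolutelyContinuous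
  · have : 0 ≤ p - 1 := by linarith
    refine ENNReal.rpow_le_rpow (lintegral_mono_set (Ioo_subset_Ioo_right hxy)) (by positivity)

/-- Hölder's inequality with the weight `v`. It fails for `σ_p = ∞` under the convention
`∞ * 0 = 0`: on a set where `v = 0` the right-hand side may vanish while `∫ h > 0`. -/
theorem lintegral_le_sigma_mul {p : ℝ} (hp : 1 ≤ p) {v h : ℝ → ℝ≥0∞} {E : Set ℝ} {a x : ℝ}
    (hE : E ⊆ Ioo a x) (hh : AEMeasurable h (volume.restrict E))
    (hv : AEMeasurable v (volume.restrict E)) (hvtop : ∀ᵐ t ∂volume.restrict E, v t < ∞)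
    (hσ : sigma p v a x ≠ ∞) :
    ∫⁻ t in E, h t ≤ sigma p v a x * (∫⁻ t in E, h t ^ p * v t) ^ (1 / p) := by
  have hac : volume.restrict E ≤ volume.restrict (Ioo a x) := Measure.restrict_mono hE le_rfl
  rcases hp.eq_or_lt with rfl | hp1
  · have hle : ∀ᵐ t ∂volume.restrict E, (v t)⁻¹ ≤ sigma 1 v a x := by
      refine ae_mono hac ?_
      simp only [sigma, if_true]
      exact ENNReal.ae_le_essSup _
    simp only [ENNReal.rpow_one, div_one]
    rw [mul_comm, ← lintegral_mul_const' _ _ hσ]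
    refine lintegral_mono_ae ?_
    filter_upwards [hle, hvtop] with t h1 h2
    have h0 : v t ≠ 0 := fun h0 => hσ (top_le_iff.1 (by simpa [h0] using h1))
    calc h t = h t * v t * (v t)⁻¹ := by
          rw [mul_assoc, ENNReal.mul_inv_cancel h0 h2.ne, mul_one]
      _ ≤ _ := by gcongr
  · have hp0 : 0 < p := by linarith
    have hd : 0 < p - 1 := by linarith
    have hc : p.HolderConjugate (p / (p - 1)) := Real.HolderConjugate.conjExponent hp1
    have hI : ∫⁻ t in Ioo a x, v t ^ (1 - p / (p - 1)) ≠ ∞ := by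
      intro hI
      apply hσ
      rw [sigma, if_neg hp1.ne', hI, ENNReal.top_rpow_of_pos (by positivity)]
    have hexp : 1 - p / (p - 1) < 0 := by
      rw [sub_neg, one_lt_div hd]; linarith
    have h0 : ∀ᵐ t ∂volume.restrict E, v t ≠ 0 := by
      have := ae_lt_top' (hv.pow_const (1 - p / (p - 1)))
        (ne_top_of_le_ne_top hI (lintegral_mono' hac le_rfl))
      filter_upwards [this] with t ht h0
      simp [h0, ENNReal.zero_rpow_of_neg hexp] at ht
    have key := ENNReal.lintegral_mul_le_Lp_mul_Lq (volume.restrict E) hc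
      (f := fun t => h t * v t ^ (1 / p)) (g := fun t => v t ^ (-(1 / p)))
      (hh.mul (hv.pow_const _)) (hv.pow_const _)
    have e1 : ∀ t, (h t * v t ^ (1 / p)) ^ p = h t ^ p * v t := fun t => by
      rw [ENNReal.mul_rpow_of_nonneg _ _ hp0.le, ← ENNReal.rpow_mul, one_div_mul_cancel hp0.ne',
        ENNReal.rpow_one]
    have e2 : ∀ t, (v t ^ (-(1 / p))) ^ (p / (p - 1)) = v t ^ (1 - p / (p - 1)) := fun t => by
      rw [← ENNReal.rpow_mul]
      congr 1
      field_simp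
      ring
    simp only [e1, e2] at key
    calc ∫⁻ t in E, h t
        = ∫⁻ t in E, ((fun t => h t * v t ^ (1 / p)) * fun t => v t ^ (-(1 / p))) t := by
          refine lintegral_congr_ae ?_
          filter_upwards [h0, hvtop] with t ht ht'
          rw [Pi.mul_apply, mul_assoc, ← ENNReal.rpow_add _ _ ht ht'.ne, add_neg_cancel,
            ENNReal.rpow_zero, mul_one]
      _ ≤ _ := key
      _ ≤ sigma p v a x * (∫⁻ t in E, h t ^ p * v t) ^ (1 / p) := by
          rw [mul_comm, sigma, if_neg hp1.ne']
          gcongr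

/-- The primitive of a bounded function is nondecreasing and continuous, so each level `y` below
its value at `t` is attained, and the sublevel set of `y` is a closed half-line `(-∞, d]`. -/
theorem exists_level {a : ℝ} {h : ℝ → ℝ≥0∞} {N : ℝ≥0} (hN : ∀ t, h t ≤ N) :
    Monotone (fun t => ∫⁻ s in Ioo a t, h s) ∧
    ∀ (y : ℝ≥0∞) (t : ℝ), y < ∫⁻ s in Ioo a t, h s → ∃ d, a ≤ d ∧ d < t ∧
      ∫⁻ s in Ioo a d, h s = y ∧ ∀ s, ∫⁻ r in Ioo a s, h r ≤ y ↔ s ≤ d := by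
  set H : ℝ → ℝ≥0∞ := fun t => ∫⁻ s in Ioo a t, h s with hH
  have mono : Monotone H := fun s t hst => lintegral_mono_set (Ioo_subset_Ioo_right hst)
  have hadd : ∀ s t, H t ≤ H s + ENNReal.ofReal (N * dist t s) := by
    intro s t
    have hsub : Ioo a t ⊆ Ioo a s ∪ Ico s t := fun x hx => by
      rcases lt_or_ge x s with h | h
      · exact Or.inl ⟨hx.1, h⟩
      · exact Or.inr ⟨h, hx.2⟩
    refine ((lintegral_mono_set hsub).trans (lintegral_union_le _ _ _)).trans ?_
    gcongr
    calc ∫⁻ r in Ico s t, h r ≤ ∫⁻ r in Ico s t, (N : ℝ≥0∞) := lintegral_mono fun r => hN r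
      _ = N * ENNReal.ofReal (t - s) := by simp
      _ = ENNReal.ofReal (N * (t - s)) := by
          rw [ENNReal.ofReal_mul N.coe_nonneg, ENNReal.ofReal_coe_nnreal]
      _ ≤ _ := by
          gcongr
          exact le_abs_self _
  have ha : H a = 0 := by simp [hH]
  have hfin : ∀ t, H t ≠ ∞ := fun t =>
    ne_top_of_le_ne_top (by rw [ha, zero_add]; exact ENNReal.ofReal_ne_top) (hadd a t)
  have hcont : Continuous H := by
    have hL : LipschitzWith N fun t => (H t).toReal := by
      refine LipschitzWith.of_le_add_mul N fun t s => ?_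
      have h0 : (0:ℝ) ≤ N * dist t s := by positivity
      rw [← ENNReal.toReal_ofReal h0, ← ENNReal.toReal_add (hfin s) ENNReal.ofReal_ne_top]
      exact ENNReal.toReal_mono (ENNReal.add_ne_top.2 ⟨hfin s, ENNReal.ofReal_ne_top⟩) (hadd s t)
    have : H = fun t => ENNReal.ofReal (H t).toReal := by
      funext t; rw [ENNReal.ofReal_toReal (hfin t)]
    rw [this]
    exact ENNReal.continuous_ofReal.comp hL.continuous
  refine ⟨mono, fun y t hy => ?_⟩
  have hat : a ≤ t := by
    by_contra! h
    exact absurd (mono h.le) (by rw [ha]; exact not_le.2 (bot_le.trans_lt hy))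
  set S := {s | H s ≤ y}
  have hSne : S.Nonempty := ⟨a, by simp [S, ha]⟩
  have hlt : ∀ s ∈ S, s < t := fun s hs => lt_of_not_ge fun hts =>
    absurd (mono hts) (not_le.2 (lt_of_le_of_lt hs hy))
  have hSb : BddAbove S := ⟨t, fun s hs => (hlt s hs).le⟩
  have hmem : sSup S ∈ S := (isClosed_Iic.preimage hcont).csSup_mem hSne hSb
  have hiff : ∀ s, H s ≤ y ↔ s ≤ sSup S := fun s =>
    ⟨fun hs => le_csSup hSb hs, fun hs => (mono hs).trans hmem⟩
  obtain ⟨c, -, hc⟩ := intermediate_value_Icc hat hcont.continuousOn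
    (show y ∈ Icc (H a) (H t) from ⟨by simp [ha], hy.le⟩)
  exact ⟨sSup S, (hiff a).1 (by simp [ha]), hlt _ hmem,
    le_antisymm hmem (hc ▸ mono ((hiff c).1 hc.le)), hiff⟩

/-! ### Level blocks -/

theorem measurableSet_of_forall_Ioo_subset {a : ℝ} {J : Set ℝ} (hJa : J ⊆ Ioi a)
    (hJ : ∀ t ∈ J, Ioo a t ⊆ J) : MeasurableSet J := by
  refine OrdConnected.measurableSet ⟨fun x hx y hy z hz => ?_⟩
  rcases hz.2.eq_or_lt with rfl | h
  · exact hy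
  · exact hJ y hy ⟨(hJa hx).trans_le hz.1, h⟩

/-- Blocking of `J` by the dyadic levels of the primitive `H(t) = ∫_a^t h`: the block `E k` is
`{t ∈ J | 2^k < H t ≤ 2^(k+1)}`. If it is nonempty, the block `E (k - 1)` contains a nondegenerate
interval. The point `x k` is taken there, so that it can avoid a null set on which `P` fails; it
lies between `E (k - 2)` and `E k`, and `E (k - 2)` carries the mass `2^(k-2)` of `h`. -/
theorem exists_level_blocks {a : ℝ} {J : Set ℝ} (hJa : J ⊆ Ioi a) (hJ : ∀ t ∈ J, Ioo a t ⊆ J)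
    {h : ℝ → ℝ≥0∞} {N : ℝ≥0} (hN : ∀ t, h t ≤ N) {P : ℝ → Prop}
    (hP : ∀ᵐ x ∂volume.restrict J, P x) :
    ∃ (E : ℤ → Set ℝ) (x : ℤ → ℝ), (∀ k, MeasurableSet (E k)) ∧
      Pairwise (Function.onFun Disjoint E) ∧ (∀ k, E k ⊆ J) ∧
      (∀ t ∈ J, ∫⁻ s in Ioo a t, h s ≠ 0 → ∃ k, t ∈ E k) ∧
      (∀ k, ∀ t ∈ E k, ∫⁻ s in Ioo a t, h s ≤ 2 ^ (k + 1)) ∧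
      ∀ k, (E k).Nonempty → P (x k) ∧ x k ∈ J ∧ E k ⊆ Ioi (x k) ∧ E (k - 2) ⊆ Iio (x k) ∧
        2 ^ (k - 2) ≤ ∫⁻ t in E (k - 2), h t := by
  obtain ⟨mono, level⟩ := exists_level (a := a) hN
  set H : ℝ → ℝ≥0∞ := fun t => ∫⁻ s in Ioo a t, h s with hH
  have hJm := measurableSet_of_forall_Ioo_subset hJa hJ
  have h2lt : ∀ k l : ℤ, k < l → (2 : ℝ≥0∞) ^ k < 2 ^ l := fun k l hkl => by
    have : (2 : ℝ≥0∞) = ((2 : ℝ≥0) : ℝ≥0∞) := rfl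
    rw [this, ← ENNReal.coe_zpow (by norm_num), ← ENNReal.coe_zpow (by norm_num)]
    exact ENNReal.coe_lt_coe.2 (zpow_lt_zpow_right₀ one_lt_two hkl)
  set E : ℤ → Set ℝ := fun k => J ∩ H ⁻¹' Ioc (2 ^ k) (2 ^ (k + 1)) with hE
  have hEm : ∀ k, MeasurableSet (E k) := fun k => hJm.inter (mono.measurable measurableSet_Ioc)
  have hmain : ∀ k, ∃ x, (E k).Nonempty → P x ∧ x ∈ J ∧ E k ⊆ Ioi x ∧ E (k - 2) ⊆ Iio x ∧
        2 ^ (k - 2) ≤ ∫⁻ t in E (k - 2), h t := by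
    intro k
    by_cases hne : (E k).Nonempty
    swap
    · exact ⟨0, fun h => absurd h hne⟩
    obtain ⟨t, htJ, ht, -⟩ := hne
    -- `dᵢ` is the largest point at which the primitive is `2 ^ (k - 2 + i)`.
    obtain ⟨d₂, ha₂, hd₂, hHd₂, hiff₂⟩ := level (2 ^ k) t ht
    obtain ⟨d₁, ha₁, hd₁, hHd₁, hiff₁⟩ := level (2 ^ (k - 1)) d₂
      (by rw [hHd₂]; exact h2lt _ _ (by omega))
    obtain ⟨d₀, ha₀, hd₀, hHd₀, hiff₀⟩ := level (2 ^ (k - 2)) d₁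
      (by rw [hHd₁]; exact h2lt _ _ (by omega))
    have hIJ : Ioo d₁ d₂ ⊆ J := fun s hs => hJ t htJ ⟨ha₁.trans_lt hs.1, hs.2.trans hd₂⟩
    have hex : ∃ x ∈ Ioo d₁ d₂, P x := by
      by_contra! hno
      have h0 : volume (Ioo d₁ d₂) = 0 := by
        rw [ae_restrict_iff' hJm] at hP
        refine measure_mono_null (fun s hs => ?_) hP
        simp only [mem_compl_iff, mem_ofPred_eq, Classical.not_imp]
        exact ⟨hIJ hs, hno s hs⟩
      rw [Real.volume_Ioo, ENNReal.ofReal_eq_zero] at h0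
      linarith
    obtain ⟨x, hx, hPx⟩ := hex
    refine ⟨x, fun _ => ⟨hPx, hIJ hx, ?_, ?_, ?_⟩⟩
    · intro s hs
      have := hs.2.1
      rw [← not_le, hiff₂, not_le] at this
      exact hx.2.trans this
    · intro s hs
      have := hs.2.2
      rw [show k - 2 + 1 = k - 1 by ring, hiff₁] at this
      exact this.trans_lt hx.1
    · have hsub : Ioo a d₁ ⊆ Ioo a d₀ ∪ {d₀} ∪ E (k - 2) := by
        intro s hs
        rcases lt_trichotomy s d₀ with h | h | h
        · exact Or.inl (Or.inl ⟨hs.1, h⟩)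
        · exact Or.inl (Or.inr h)
        · refine Or.inr ⟨hJ t htJ ⟨hs.1, hs.2.trans (hd₁.trans hd₂)⟩, ?_, ?_⟩
          · rw [← not_le, hiff₀, not_le]; exact h
          · rw [show k - 2 + 1 = k - 1 by ring, hiff₁]; exact hs.2.le
      have hle : (2 : ℝ≥0∞) ^ (k - 1) ≤ 2 ^ (k - 2) + ∫⁻ t in E (k - 2), h t := by
        rw [← hHd₁, ← hHd₀]
        refine ((lintegral_mono_set hsub).trans (lintegral_union_le _ _ _)).trans ?_
        refine add_le_add ((lintegral_union_le _ _ _).trans ?_) le_rfl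
        simp
      have htwo : (2 : ℝ≥0∞) ^ (k - 1) = 2 ^ (k - 2) + 2 ^ (k - 2) := by
        rw [show k - 1 = (k - 2) + 1 by ring, ENNReal.zpow_add (by norm_num) (by norm_num),
          zpow_one, mul_two]
      rw [htwo] at hle
      refine (ENNReal.add_le_add_iff_left ?_).1 hle
      exact (ENNReal.zpow_lt_top (by norm_num) (by norm_num) _).ne
  choose x hx using hmain
  refine ⟨E, x, hEm, ?_, fun k => inter_subset_left, ?_, fun k t ht => ht.2.2, hx⟩
  · have hm : Monotone fun k : ℤ => (2 : ℝ≥0∞) ^ k := fun k l hkl => by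
      rcases hkl.eq_or_lt with rfl | h
      · exact le_rfl
      · exact (h2lt k l h).le
    have := hm.pairwise_disjoint_on_Ioc_succ
    intro k l hkl
    exact ((this hkl).preimage H).mono inter_subset_right inter_subset_right
  · intro t ht h0
    have hfin : H t ≠ ∞ := by
      refine ne_top_of_le_ne_top ?_ (lintegral_mono fun s => hN s)
      simp [ENNReal.mul_eq_top]
    obtain ⟨k, hk⟩ := ENNReal.exists_mem_Ioc_zpow (y := 2) h0 hfin (by norm_num) (by norm_num)
    exact ⟨k, ht, hk⟩

/-- Discretization of the left-hand side of Hardy's inequality along the level blocks. On `E k` the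
primitive of `h` is at most `2^(k+1) = 8 * 2^(k-2)`, and `2^(k-2) ≤ ∫_{E (k-2)} h` is estimated by
Hölder's inequality. Here `g k` is the norm of `h` in `L^p(v)` on `E (k - 2)`. -/
theorem lintegral_primitive_rpow_mul_le {p q : ℝ} (hp : 1 ≤ p) (hq : 0 < q) {a : ℝ} (ha : 0 ≤ a)
    {J : Set ℝ} (hJa : J ⊆ Ioi a) (hJ : ∀ t ∈ J, Ioo a t ⊆ J)
    {h v w : ℝ → ℝ≥0∞} (hh : MeasPos h) (hv : MeasPos v)
    (hvtop : ∀ᵐ t ∂volume.restrict (Ioi 0), v t < ∞) {N : ℝ≥0} (hN : ∀ t, h t ≤ N) {P : ℝ → Prop}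
    (hP : ∀ᵐ x ∂volume.restrict J, P x) :
    ∃ (E : ℤ → Set ℝ) (x : ℤ → ℝ) (g : ℤ → ℝ≥0∞), (∀ k, MeasurableSet (E k)) ∧
      Pairwise (Function.onFun Disjoint E) ∧ (∀ k, E k ⊆ J) ∧
      (∀ k, (E k).Nonempty → P (x k) ∧ x k ∈ J ∧ E k ⊆ Ioi (x k)) ∧
      (∑' k, g k ^ p) ^ (1 / p) ≤ (∫⁻ t in J, h t ^ p * v t) ^ (1 / p) ∧
      ((∀ k, (∫⁻ t in E k, w t) ^ (1 / q) * sigma p v 0 (x k) ≠ ∞) →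
        (∫⁻ t in J, (∫⁻ s in Ioo a t, h s) ^ q * w t) ^ (1 / q) ≤
          8 * (∑' k, ((∫⁻ t in E k, w t) ^ (1 / q) * sigma p v 0 (x k) * g k) ^ q) ^ (1 / q)) := by
  obtain ⟨E, x, hEm, hdisj, hEJ, hcov, hup, hx⟩ := exists_level_blocks hJa hJ hN hP
  have hp0 : 0 < p := by linarith
  have hJm := measurableSet_of_forall_Ioo_subset hJa hJ
  have hJ0 : J ⊆ Ioi 0 := fun t ht => ha.trans_lt (hJa ht)
  refine ⟨E, x, fun k => (∫⁻ t in E (k - 2), h t ^ p * v t) ^ (1 / p), hEm, hdisj, hEJ,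
    fun k hk => ⟨(hx k hk).1, (hx k hk).2.1, (hx k hk).2.2.1⟩, ?_, fun hfin => ?_⟩
  · gcongr
    calc ∑' k, ((∫⁻ t in E (k - 2), h t ^ p * v t) ^ (1 / p)) ^ p
        = ∑' k, ∫⁻ t in E (k - 2), h t ^ p * v t := by
          simp only [← ENNReal.rpow_mul, one_div_mul_cancel hp0.ne', ENNReal.rpow_one]
      _ = ∑' k, ∫⁻ t in E k, h t ^ p * v t :=
          (Equiv.subRight (2 : ℤ)).tsum_eq fun k => ∫⁻ t in E k, h t ^ p * v t
      _ = ∫⁻ t in ⋃ k, E k, h t ^ p * v t := (lintegral_iUnion hEm hdisj _).symm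
      _ ≤ _ := lintegral_mono_set (iUnion_subset hEJ)
  · have hblock : ∀ k, ∫⁻ t in E k, (∫⁻ s in Ioo a t, h s) ^ q * w t ≤
        8 ^ q * ((∫⁻ t in E k, w t) ^ (1 / q) * sigma p v 0 (x k) *
          (∫⁻ t in E (k - 2), h t ^ p * v t) ^ (1 / p)) ^ q := by
      intro k
      have htop : ((2 : ℝ≥0∞) ^ (k + 1)) ^ q ≠ ∞ :=
        ENNReal.rpow_ne_top_of_nonneg hq.le (ENNReal.zpow_lt_top (by norm_num) (by norm_num) _).ne
      have h1 : ∫⁻ t in E k, (∫⁻ s in Ioo a t, h s) ^ q * w t ≤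
          (2 ^ (k + 1)) ^ q * ∫⁻ t in E k, w t := by
        rw [← lintegral_const_mul' _ _ htop]
        refine setLIntegral_mono' (hEm k) fun t ht => ?_
        gcongr
        exact hup k t ht
      by_cases hw : ∫⁻ t in E k, w t = 0
      · rw [hw, mul_zero] at h1
        exact h1.trans bot_le
      have hne : (E k).Nonempty := by
        by_contra hne
        rw [not_nonempty_iff_eq_empty] at hne
        simp [hne] at hw
      obtain ⟨-, hxJ, -, hlt, hge⟩ := hx k hne
      -- A block of positive `w`-mass forces `σ < ∞`, so Hölder's inequality is not `∞ * 0`.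
      have hσ : sigma p v 0 (x k) ≠ ∞ := by
        intro hσ
        refine hfin k ?_
        rw [hσ, ENNReal.mul_top]
        simp [hw, hq.le, hq]
      have hE0 : E (k - 2) ⊆ Ioi 0 := (hEJ _).trans hJ0
      have hac : volume.restrict (E (k - 2)) ≤ volume.restrict (Ioi (0 : ℝ)) :=
        Measure.restrict_mono hE0 le_rfl
      have h2 := hge.trans (lintegral_le_sigma_mul hp (a := 0) (x := x k)
        (fun t ht => ⟨hE0 ht, hlt ht⟩) (hh.mono_measure hac) (hv.mono_measure hac)
        (ae_mono hac hvtop) hσ)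
      have h3 : (2 : ℝ≥0∞) ^ (k + 1) = 8 * 2 ^ (k - 2) := by
        rw [show k + 1 = 3 + (k - 2) by ring, ENNReal.zpow_add (by norm_num) (by norm_num)]
        norm_num
      calc _ ≤ _ := h1
        _ ≤ (8 * (sigma p v 0 (x k) * (∫⁻ t in E (k - 2), h t ^ p * v t) ^ (1 / p))) ^ q *
              ∫⁻ t in E k, w t := by
            rw [h3]
            gcongr
        _ = _ := by
            simp only [ENNReal.mul_rpow_of_nonneg _ _ hq.le]
            rw [← ENNReal.rpow_mul (∫⁻ t in E k, w t), one_div_mul_cancel hq.ne', ENNReal.rpow_one]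
            ring
    have htotal : ∫⁻ t in J, (∫⁻ s in Ioo a t, h s) ^ q * w t ≤
        8 ^ q * ∑' k, ((∫⁻ t in E k, w t) ^ (1 / q) * sigma p v 0 (x k) *
          (∫⁻ t in E (k - 2), h t ^ p * v t) ^ (1 / p)) ^ q := by
      calc ∫⁻ t in J, (∫⁻ s in Ioo a t, h s) ^ q * w t
          ≤ ∫⁻ t in J, (⋃ k, E k).indicator (fun t => (∫⁻ s in Ioo a t, h s) ^ q * w t) t := by
            refine setLIntegral_mono' hJm fun t ht => ?_
            by_cases h0 : ∫⁻ s in Ioo a t, h s = 0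
            · simp [h0, hq]
            · obtain ⟨k, hk⟩ := hcov t ht h0
              rw [indicator_of_mem (mem_iUnion.2 ⟨k, hk⟩)]
        _ ≤ ∫⁻ t in ⋃ k, E k, (∫⁻ s in Ioo a t, h s) ^ q * w t := by
            rw [← lintegral_indicator (MeasurableSet.iUnion hEm)]
            exact lintegral_mono' Measure.restrict_le_self le_rfl
        _ = ∑' k, ∫⁻ t in E k, (∫⁻ s in Ioo a t, h s) ^ q * w t := lintegral_iUnion hEm hdisj _
        _ ≤ _ := by
            rw [← ENNReal.tsum_mul_left]
            exact ENNReal.tsum_le_tsum hblock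
    rw [one_div, ENNReal.rpow_inv_le_iff hq, ENNReal.mul_rpow_of_nonneg _ _ hq.le,
      ENNReal.rpow_inv_rpow hq.ne']
    simpa only [one_div] using htotal

/-! ### Hardy inequalities on an interval -/

theorem IsWeight.ae_lt_top {v : ℝ → ℝ≥0∞} (hv : IsWeight v) :
    ∀ᵐ t ∂volume.restrict (Ioi 0), v t < ∞ := by
  have hU : Ioi (0 : ℝ) = ⋃ n : ℕ, Ioo 0 ((n : ℝ) + 1) := by
    ext t
    simp only [mem_Ioi, mem_iUnion, mem_Ioo]
    refine ⟨fun ht => ?_, fun ⟨_, h, _⟩ => h⟩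
    obtain ⟨n, hn⟩ := exists_nat_gt t
    exact ⟨n, ht, by linarith⟩
  rw [hU, ae_restrict_iUnion_iff]
  intro n
  exact ae_lt_top' (hv.meas.mono_measure (Measure.restrict_mono Ioo_subset_Ioi_self le_rfl))
    (hv.finite _ (by positivity)).ne

/-- Truncation `min h n` and monotone convergence extend a Hardy inequality from bounded functions
to all of `𝔐⁺`. Bounded functions have finite primitives even where `σ_p = ∞`. -/
theorem hardy_of_forall_bounded {p q : ℝ} (hp : 0 < p) (hq : 0 < q) {a : ℝ} (ha : 0 ≤ a)
    {J : Set ℝ} (hJa : J ⊆ Ioi a) {v w : ℝ → ℝ≥0∞} (hw : MeasPos w) {C : ℝ≥0∞}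
    (H : ∀ h : ℝ → ℝ≥0∞, MeasPos h → ∀ N : ℝ≥0, (∀ t, h t ≤ N) →
      (∫⁻ t in J, (∫⁻ s in Ioo a t, h s) ^ q * w t) ^ (1 / q) ≤
        C * (∫⁻ t in J, h t ^ p * v t) ^ (1 / p))
    {h : ℝ → ℝ≥0∞} (hh : MeasPos h) :
    (∫⁻ t in J, (∫⁻ s in Ioo a t, h s) ^ q * w t) ^ (1 / q) ≤
      C * (∫⁻ t in J, h t ^ p * v t) ^ (1 / p) := by
  have hJ0 : J ⊆ Ioi 0 := fun t ht => ha.trans_lt (hJa ht)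
  set f : ℕ → ℝ → ℝ≥0∞ := fun n t => min (h t) n with hf
  have hfm : ∀ n, MeasPos (f n) := fun n => hh.min aemeasurable_const
  have hfmono : ∀ t, Monotone fun n => f n t := fun t m n hmn =>
    min_le_min le_rfl (by exact_mod_cast hmn)
  have hfsup : ∀ t, ⨆ n, f n t = h t := fun t => by
    have : ⨆ n, f n t = h t ⊓ ⨆ n : ℕ, (n : ℝ≥0∞) := (inf_iSup_eq _ _).symm
    rw [this, ENNReal.iSup_natCast, inf_top_eq]
  have hin : ∀ t, ∫⁻ s in Ioo a t, h s = ⨆ n, ∫⁻ s in Ioo a t, f n s := fun t => by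
    rw [← lintegral_iSup' (fun n => (hfm n).mono_measure (Measure.restrict_mono
      (fun s hs => ha.trans_lt hs.1) le_rfl)) (.of_forall hfmono)]
    simp only [hfsup]
  have hpt : ∀ t, (∫⁻ s in Ioo a t, h s) ^ q * w t =
      ⨆ n, (∫⁻ s in Ioo a t, f n s) ^ q * w t := fun t => by
    rw [hin, ← ENNReal.iSup_mul]
    congr 1
    exact (ENNReal.orderIsoRpow q hq).map_iSup _
  have hout : ∫⁻ t in J, (∫⁻ s in Ioo a t, h s) ^ q * w t =
      ⨆ n, ∫⁻ t in J, (∫⁻ s in Ioo a t, f n s) ^ q * w t := by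
    simp only [hpt]
    refine lintegral_iSup' (fun n => ?_) (.of_forall fun t m n hmn => ?_)
    · have hm : Monotone fun t => ∫⁻ s in Ioo a t, f n s := fun s t hst =>
        lintegral_mono_set (Ioo_subset_Ioo_right hst)
      exact (hm.measurable.pow_const q).aemeasurable.mul
        (hw.mono_measure (Measure.restrict_mono hJ0 le_rfl))
    · dsimp only
      gcongr
      exact hfmono _ hmn
  rw [one_div q, ENNReal.rpow_inv_le_iff hq, hout]
  refine iSup_le fun n => ?_
  rw [← ENNReal.rpow_inv_le_iff hq, ← one_div]
  refine (H (f n) (hfm n) n fun t => min_le_right _ _).trans ?_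
  gcongr
  exact min_le_left _ _

/-- Hardy's inequality on an interval `J` with left endpoint `a`, for `p ≤ q`. The Muckenhoupt-type
condition is only needed almost everywhere. -/
theorem hardy_of_le {p q : ℝ} (hp : 1 ≤ p) (hpq : p ≤ q) {a : ℝ} (ha : 0 ≤ a)
    {J : Set ℝ} (hJa : J ⊆ Ioi a) (hJ : ∀ t ∈ J, Ioo a t ⊆ J) {h v w : ℝ → ℝ≥0∞}
    (hv : IsWeight v) (hw : MeasPos w) {A : ℝ≥0∞} (hA : A ≠ ∞)
    (hP : ∀ᵐ x ∂volume.restrict J, (∫⁻ s in Ioi x, w s) ^ (1 / q) * sigma p v 0 x ≤ A)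
    (hh : MeasPos h) :
    (∫⁻ t in J, (∫⁻ s in Ioo a t, h s) ^ q * w t) ^ (1 / q) ≤
      8 * A * (∫⁻ t in J, h t ^ p * v t) ^ (1 / p) := by
  have hp0 : 0 < p := by linarith
  have hq : 0 < q := by linarith
  refine hardy_of_forall_bounded hp0 hq ha hJa hw (fun h hh N hN => ?_) hh
  obtain ⟨E, x, g, -, -, -, hx, hg, hmain⟩ :=
    lintegral_primitive_rpow_mul_le (w := w) hp hq ha hJa hJ hh hv.meas hv.ae_lt_top hN hP
  have hle : ∀ k, (∫⁻ t in E k, w t) ^ (1 / q) * sigma p v 0 (x k) ≤ A := by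
    intro k
    rcases (E k).eq_empty_or_nonempty with h0 | hne
    · simp [h0, hq]
    · obtain ⟨h1, -, h3⟩ := hx k hne
      refine le_trans ?_ h1
      gcongr
  refine (hmain fun k => ne_top_of_le_ne_top hA (hle k)).trans ?_
  rw [mul_assoc]
  gcongr
  refine (tsum_mul_rpow_le_of_le _ _ hp0 hpq hle).trans ?_
  gcongr

/-- Hardy's inequality on an interval `J` with left endpoint `a`, for `q < p`, with the
Maz'ya-type constant. -/
theorem hardy_of_lt {p q : ℝ} (hp : 1 ≤ p) (hq : 0 < q) (hqp : q < p) {a : ℝ} (ha : 0 ≤ a)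
    {J : Set ℝ} (hJa : J ⊆ Ioi a) (hJ : ∀ t ∈ J, Ioo a t ⊆ J) {h v w : ℝ → ℝ≥0∞}
    (hv : IsWeight v) (hw : IsWeight w)
    (hD : ∫⁻ x in J, (∫⁻ s in Ioi x, w s) ^ (q / (p - q)) * w x *
      sigma p v 0 x ^ (p * q / (p - q)) ≠ ∞)
    (hh : MeasPos h) :
    (∫⁻ t in J, (∫⁻ s in Ioo a t, h s) ^ q * w t) ^ (1 / q) ≤
      8 * (2 ^ (p / (p - q))) ^ ((p - q) / (p * q)) *
        (∫⁻ x in J, (∫⁻ s in Ioi x, w s) ^ (q / (p - q)) * w x *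
          sigma p v 0 x ^ (p * q / (p - q))) ^ ((p - q) / (p * q)) *
        (∫⁻ t in J, h t ^ p * v t) ^ (1 / p) := by
  have hp0 : 0 < p := by linarith
  have hd : 0 < p - q := sub_pos.2 hqp
  have hJ0 : J ⊆ Ioi 0 := fun t ht => ha.trans_lt (hJa ht)
  refine hardy_of_forall_bounded hp0 hq ha hJa hw.meas (fun h hh N hN => ?_) hh
  obtain ⟨E, x, g, hEm, hdisj, hEJ, hx, hg, hmain⟩ :=
    lintegral_primitive_rpow_mul_le (w := w) (P := fun _ => True) hp hq ha hJa hJ hh hv.meas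
      hv.ae_lt_top hN (.of_forall fun _ => trivial)
  set F : ℝ → ℝ≥0∞ := fun x => (∫⁻ s in Ioi x, w s) ^ (q / (p - q)) * w x *
      sigma p v 0 x ^ (p * q / (p - q)) with hF
  have hα : 0 ≤ q / (p - q) := by positivity
  have hs : 0 < p * q / (p - q) := by positivity
  have h1α : p / (p - q) = 1 + q / (p - q) := by field_simp; ring
  have hblock : ∀ k, ((∫⁻ t in E k, w t) ^ (1 / q) * sigma p v 0 (x k)) ^ (p * q / (p - q)) ≤
      2 ^ (p / (p - q)) * ∫⁻ t in E k, F t := by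
    intro k
    rcases (E k).eq_empty_or_nonempty with h0 | hne
    · have hq' : 0 < 1 / q := by positivity
      rw [h0, Measure.restrict_empty, lintegral_zero_measure, ENNReal.zero_rpow_of_pos hq',
        zero_mul, ENNReal.zero_rpow_of_pos hs]
      exact bot_le
    obtain ⟨-, -, h3⟩ := hx k hne
    have hfin : ∀ y, ∫⁻ t in Iic y, w t ∂volume.restrict (E k) ≠ ∞ := by
      intro y
      refine ne_top_of_le_ne_top (hw.finite (max y 0 + 1) (by positivity)).ne ?_
      rw [Measure.restrict_restrict measurableSet_Iic]
      refine lintegral_mono_set fun t ht => ⟨hJ0 (hEJ k ht.2), ?_⟩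
      have := le_max_left y 0
      have := ht.1
      simp only [mem_Iic] at this
      linarith
    have htail := rpow_lintegral_le_lintegral_tail w hα hfin
    rw [← h1α] at htail
    calc ((∫⁻ t in E k, w t) ^ (1 / q) * sigma p v 0 (x k)) ^ (p * q / (p - q))
        = (∫⁻ t in E k, w t) ^ (p / (p - q)) * sigma p v 0 (x k) ^ (p * q / (p - q)) := by
          rw [ENNReal.mul_rpow_of_nonneg _ _ hs.le, ← ENNReal.rpow_mul]
          congr 2
          field_simp
      _ ≤ 2 ^ (p / (p - q)) * (∫⁻ y in E k, (∫⁻ t in Ioi y, w t ∂volume.restrict (E k)) ^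
            (q / (p - q)) * w y) * sigma p v 0 (x k) ^ (p * q / (p - q)) := by gcongr
      _ ≤ 2 ^ (p / (p - q)) * ∫⁻ y in E k, (∫⁻ t in Ioi y, w t ∂volume.restrict (E k)) ^
            (q / (p - q)) * w y * sigma p v 0 (x k) ^ (p * q / (p - q)) := by
          rw [mul_assoc]
          gcongr
          exact lintegral_mul_const_le _ _
      _ ≤ _ := by
          gcongr 2 ^ (p / (p - q)) * ?_
          refine setLIntegral_mono' (hEm k) fun y hy => ?_
          simp only [hF]
          gcongr
          · exact Measure.restrict_le_self
          · exact sigma_mono_right p hp v 0 (le_of_lt (h3 hy))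
  have hsum : ∑' k, ((∫⁻ t in E k, w t) ^ (1 / q) * sigma p v 0 (x k)) ^ (p * q / (p - q)) ≤
      2 ^ (p / (p - q)) * ∫⁻ t in J, F t := by
    refine (ENNReal.tsum_le_tsum hblock).trans ?_
    rw [ENNReal.tsum_mul_left, ← lintegral_iUnion hEm hdisj]
    gcongr
    exact iUnion_subset hEJ
  have h2top : (2 : ℝ≥0∞) ^ (p / (p - q)) ≠ ∞ :=
    ENNReal.rpow_ne_top_of_nonneg (by positivity) (by norm_num)
  have hsumtop := ne_top_of_le_ne_top (ENNReal.mul_ne_top h2top hD) hsum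
  have hfin : ∀ k, (∫⁻ t in E k, w t) ^ (1 / q) * sigma p v 0 (x k) ≠ ∞ := fun k hk => by
    refine ENNReal.ne_top_of_tsum_ne_top hsumtop k ?_
    rw [hk, ENNReal.top_rpow_of_pos hs]
  refine (hmain hfin).trans ?_
  have he : 0 ≤ (p - q) / (p * q) := by positivity
  calc _ ≤ 8 * ((2 ^ (p / (p - q)) * ∫⁻ t in J, F t) ^ ((p - q) / (p * q)) *
          (∫⁻ t in J, h t ^ p * v t) ^ (1 / p)) := by
        gcongr
        refine (tsum_mul_rpow_le_mul _ _ hq hqp).trans ?_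
        gcongr
    _ = _ := by
        rw [ENNReal.mul_rpow_of_nonneg _ _ he]
        ring

/-! ### Summation over the covering sequence -/

theorem two_zpow_eq_add (k : ℤ) : (2 : ℝ≥0∞) ^ k = 2 ^ (k - 1) + 2 ^ (k - 1) := by
  conv_lhs => rw [show k = (k - 1) + 1 by ring, ENNReal.zpow_add (by norm_num) (by norm_num),
    zpow_one, mul_two]

/-- The dyadic sum of an antitone `φ` along a covering sequence is dominated by the integral of
`U^β u φ`, where `U` is the primitive of `u`: the `k`-th summand is compared with the integral over
the preceding cell `[x (k-1), x k)`, which has `u`-mass `2^(k-1)` and on which `φ ≥ φ (x k)`. -/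
theorem tsum_two_rpow_mul_le {u : ℝ → ℝ≥0∞} {M : WithTop ℤ} {x : ℤ → ℝ}
    (hx : IsCoveringSequence u M x) {β : ℝ} (hβ : 0 ≤ β) {φ : ℝ → ℝ≥0∞} (hφ : Antitone φ) :
    ∑' k : indexSet M, (2 : ℝ≥0∞) ^ ((k : ℝ) * (1 + β)) * φ (x k) ≤
      2 ^ (1 + β) * ∫⁻ t in Ioi 0, (∫⁻ s in Ioo 0 t, u s) ^ β * u t * φ t := by
  have hpred : ∀ {k l : ℤ}, k ∈ indexSet M → l ≤ k → l ∈ indexSet M := fun {k l} hk hl =>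
    (WithTop.coe_le_coe.2 hl).trans hk
  set F : ℝ → ℝ≥0∞ := fun t => (∫⁻ s in Ioo 0 t, u s) ^ β * u t * φ t with hF
  have hblock : ∀ k : indexSet M, (2 : ℝ≥0∞) ^ ((k : ℝ) * (1 + β)) * φ (x k) ≤
      2 ^ (1 + β) * ∫⁻ t in Ico (x (k - 1)) (x k), F t := by
    rintro ⟨k, hk⟩
    dsimp only
    have hk' : k - 1 ∈ indexSet M := hpred hk (by omega)
    have hpos := hx.pos _ hk'
    have hu : (2 : ℝ≥0∞) ^ (k - 1) ≤ ∫⁻ t in Ico (x (k - 1)) (x k), u t := by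
      have hle : (2 : ℝ≥0∞) ^ k ≤ 2 ^ (k - 1) + ∫⁻ t in Ico (x (k - 1)) (x k), u t := by
        rw [← hx.integral_eq _ hk, ← hx.integral_eq _ hk']
        refine (lintegral_mono_set fun t ht => ?_).trans (lintegral_union_le _ _ _)
        rcases lt_or_ge t (x (k - 1)) with h | h
        · exact Or.inl ⟨ht.1, h⟩
        · exact Or.inr ⟨h, ht.2⟩
      rw [two_zpow_eq_add k] at hle
      exact (ENNReal.add_le_add_iff_left
        (ENNReal.zpow_lt_top (by norm_num) (by norm_num) _).ne).1 hle
    have hpow : (2 : ℝ≥0∞) ^ ((k : ℝ) * (1 + β)) =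
        2 ^ (1 + β) * ((2 ^ (k - 1)) ^ β * 2 ^ (k - 1)) := by
      rw [← ENNReal.rpow_intCast, ← ENNReal.rpow_mul, ← ENNReal.rpow_add _ _ (by norm_num)
        (by norm_num), ← ENNReal.rpow_add _ _ (by norm_num) (by norm_num)]
      congr 1
      push_cast
      ring
    rw [hpow, mul_assoc]
    gcongr
    calc (2 ^ (k - 1)) ^ β * 2 ^ (k - 1) * φ (x k)
        ≤ ((2 ^ (k - 1)) ^ β * ∫⁻ t in Ico (x (k - 1)) (x k), u t) * φ (x k) := by gcongr
      _ ≤ (∫⁻ t in Ico (x (k - 1)) (x k), (2 ^ (k - 1)) ^ β * u t) * φ (x k) := by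
          gcongr
          exact lintegral_const_mul_le _ _
      _ ≤ ∫⁻ t in Ico (x (k - 1)) (x k), (2 ^ (k - 1)) ^ β * u t * φ (x k) :=
          lintegral_mul_const_le _ _
      _ ≤ _ := by
          refine setLIntegral_mono' measurableSet_Ico fun t ht => ?_
          simp only [hF]
          gcongr
          · rw [← hx.integral_eq _ hk']
            exact lintegral_mono_set (Ioo_subset_Ioo_right ht.1)
          · exact hφ ht.2.le
  refine (ENNReal.tsum_le_tsum hblock).trans ?_
  have hdisj : Pairwise (Function.onFun Disjoint
      fun k : indexSet M => Ico (x (k - 1)) (x k)) := by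
    have key : ∀ k l : indexSet M, (k : ℤ) < l →
        Disjoint (Ico (x (k - 1)) (x k)) (Ico (x (l - 1)) (x l)) := by
      intro k l hkl
      rw [Set.disjoint_left]
      intro t h1 h2
      have : x k ≤ x (l - 1) :=
        hx.strictMonoOn.monotoneOn k.2 (hpred l.2 (by omega)) (by omega)
      exact absurd (h1.2.trans_le (this.trans h2.1)) (lt_irrefl _)
    intro k l hkl
    rcases lt_or_gt_of_ne (fun h => hkl (Subtype.ext h) : (k : ℤ) ≠ l) with h | h
    · exact key k l h
    · exact (key l k h).symm
  rw [ENNReal.tsum_mul_left, ← lintegral_iUnion (fun _ => measurableSet_Ico) hdisj]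
  gcongr
  refine iUnion_subset fun k t ht => ?_
  exact (hx.pos _ (hpred k.2 (by omega))).trans_le ht.1

/-- The Hardy inequality on the single cell `(x_k, x_{k+1})` with constant `A`, which may be `∞`. -/
def CellIneq (p q : ℝ) (v w : ℝ → ℝ≥0∞) (M : WithTop ℤ) (x : ℤ → ℝ) (k : ℤ) (A : ℝ≥0∞) : Prop :=
  ∀ h : ℝ → ℝ≥0∞, MeasPos h →
    (∫⁻ t in cell M x k, (∫⁻ s in Ioo (x k) t, h s) ^ q * w t) ^ (1 / q) ≤
      A * (∫⁻ t in cell M x k, h t ^ p * v t) ^ (1 / p)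

theorem Suffices.of_lNorm_le {p q r : ℝ} {B : (ℝ → ℝ≥0∞) → (ℝ → ℝ≥0∞) → (ℝ → ℝ≥0∞) → ℝ≥0∞}
    {K : ℝ≥0∞} (hK : K ≠ ∞)
    (H : ∀ u v w : ℝ → ℝ≥0∞, IsWeight u → IsWeight v → IsWeight w →
      ∀ (M : WithTop ℤ) (x : ℤ → ℝ), IsCoveringSequence u M x → B u v w < ∞ →
      ∀ h : ℝ → ℝ≥0∞, MeasPos h →
        lNorm (indexSet M) r (fun k => (2 : ℝ≥0∞) ^ ((k : ℝ) / r) *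
          (∫⁻ t in cell M x k, (∫⁻ s in Ioo (x k) t, h s) ^ q * w t) ^ (1 / q))
        ≤ K * B u v w *
          lNorm (indexSet M) p (fun n => (∫⁻ t in cell M x n, h t ^ p * v t) ^ (1 / p))) :
    Suffices p q r B := by
  lift K to ℝ≥0 using hK
  refine ⟨K, fun u v w hu hv hw M x hx hB => ?_⟩
  have hC : DiscreteIneq p q r v w M x (K * (B u v w).toNNReal) := by
    intro h hh
    rw [ENNReal.coe_mul, ENNReal.coe_toNNReal hB.ne]
    exact H u v w hu hv hw M x hx hB h hh
  refine ⟨⟨_, hC⟩, (iInf₂_le _ hC).trans ?_⟩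
  rw [ENNReal.coe_mul, ENNReal.coe_toNNReal hB.ne]

/-- For `p ≤ r`, the cell constants only have to satisfy `sup_k 2^{k/r} A_k ≤ B`. -/
theorem Suffices.of_cellIneq_of_le {p q r : ℝ} (hp : 0 < p) (hpr : p ≤ r)
    {B : (ℝ → ℝ≥0∞) → (ℝ → ℝ≥0∞) → (ℝ → ℝ≥0∞) → ℝ≥0∞} {c : ℝ≥0∞} (hc : c ≠ ∞)
    (H : ∀ u v w : ℝ → ℝ≥0∞, IsWeight u → IsWeight v → IsWeight w →
      ∀ (M : WithTop ℤ) (x : ℤ → ℝ), IsCoveringSequence u M x → B u v w < ∞ →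
      ∀ k ∈ indexSet M, ∃ A, CellIneq p q v w M x k (c * A) ∧
        (2 : ℝ≥0∞) ^ ((k : ℝ) / r) * A ≤ B u v w) :
    Suffices p q r B := by
  refine .of_lNorm_le hc fun u v w hu hv hw M x hx hB h hh => ?_
  have hr : 0 < r := hp.trans_le hpr
  choose! A hA hAB using H u v w hu hv hw M x hx hB
  unfold lNorm
  refine le_trans ?_ (tsum_mul_rpow_le_of_le
    (fun k : indexSet M => c * ((2 : ℝ≥0∞) ^ ((k : ℝ) / r) * A k)) _ hp hpr
    fun k => mul_le_mul_right (hAB k k.2) c)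
  gcongr with k
  rw [show ∀ P Q R : ℝ≥0∞, c * (P * Q) * R = P * (c * Q * R) by intros; ring]
  exact mul_le_mul_right (hA k k.2 h hh) _

/-- For `r < p`, the numbers `2^{k/r} A_k` have to lie in `ℓ^{pr/(p-r)}`. With
`A_k = φ(x_k)^{(p-r)/(pr)}` and `φ` antitone, their norm is controlled by the integral `B`. -/
theorem Suffices.of_cellIneq_of_lt {p q r : ℝ} (hr : 0 < r) (hrp : r < p)
    {B : (ℝ → ℝ≥0∞) → (ℝ → ℝ≥0∞) → (ℝ → ℝ≥0∞) → ℝ≥0∞} {c : ℝ≥0∞} (hc : c ≠ ∞)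
    {φ : (ℝ → ℝ≥0∞) → (ℝ → ℝ≥0∞) → ℝ → ℝ≥0∞} (hφ : ∀ v w, Antitone (φ v w))
    (hBφ : ∀ u v w, B u v w = (∫⁻ t in Ioi 0, (∫⁻ s in Ioo 0 t, u s) ^ (r / (p - r)) * u t *
      φ v w t) ^ ((p - r) / (p * r)))
    (H : ∀ v w : ℝ → ℝ≥0∞, IsWeight v → IsWeight w →
      ∀ (M : WithTop ℤ) (x : ℤ → ℝ), ∀ k ∈ indexSet M, 0 ≤ x k → φ v w (x k) ≠ ∞ →
        CellIneq p q v w M x k (c * φ v w (x k) ^ ((p - r) / (p * r)))) :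
    Suffices p q r B := by
  have hp : 0 < p := hr.trans hrp
  have hd : 0 < p - r := sub_pos.2 hrp
  have he : 0 < (p - r) / (p * r) := by positivity
  have h2 : ((2 : ℝ≥0∞) ^ (1 + r / (p - r))) ≠ ∞ :=
    ENNReal.rpow_ne_top_of_nonneg (by positivity) (by norm_num)
  refine .of_lNorm_le (K := c * (2 ^ (1 + r / (p - r))) ^ ((p - r) / (p * r)))
    (ENNReal.mul_ne_top hc (ENNReal.rpow_ne_top_of_nonneg he.le h2))
    fun u v w hu hv hw M x hx hB h hh => ?_
  have hsum := tsum_two_rpow_mul_le hx (β := r / (p - r)) (by positivity) (hφ v w)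
  have hI : ∫⁻ t in Ioi 0, (∫⁻ s in Ioo 0 t, u s) ^ (r / (p - r)) * u t * φ v w t ≠ ∞ := by
    intro hI
    rw [hBφ, hI, ENNReal.top_rpow_of_pos he] at hB
    exact lt_irrefl _ hB
  have hfin : ∀ k ∈ indexSet M, φ v w (x k) ≠ ∞ := by
    intro k hk h
    refine ENNReal.ne_top_of_tsum_ne_top
      (ne_top_of_le_ne_top (ENNReal.mul_ne_top h2 hI) hsum) ⟨k, hk⟩ ?_
    rw [h, ENNReal.mul_top (ENNReal.rpow_pos (by norm_num) (by norm_num)).ne']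
  have e : ∀ k : indexSet M, (2 : ℝ≥0∞) ^ ((k : ℝ) * (1 + r / (p - r))) * φ v w (x k) =
      ((2 : ℝ≥0∞) ^ ((k : ℝ) / r) * φ v w (x k) ^ ((p - r) / (p * r))) ^ (p * r / (p - r)) := by
    intro k
    rw [ENNReal.mul_rpow_of_nonneg _ _ (by positivity), ← ENNReal.rpow_mul, ← ENNReal.rpow_mul,
      show (p - r) / (p * r) * (p * r / (p - r)) = 1 by field_simp, ENNReal.rpow_one]
    congr 2
    field_simp
    ring
  simp only [e] at hsum
  unfold lNorm
  calc _ ≤ (∑' k : indexSet M, (((2 : ℝ≥0∞) ^ ((k : ℝ) / r) * φ v w (x k) ^ ((p - r) / (p * r))) *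
          (c * (∫⁻ t in cell M x k, h t ^ p * v t) ^ (1 / p))) ^ r) ^ (1 / r) := by
        gcongr with k
        rw [show ∀ P Q R : ℝ≥0∞, P * Q * (c * R) = P * (c * Q * R) by intros; ring]
        exact mul_le_mul_right (H v w hv hw M x k k.2 (hx.pos k k.2).le (hfin k k.2) h hh) _
    _ ≤ _ := tsum_mul_rpow_le_mul _ _ hr hrp
    _ ≤ (2 ^ (1 + r / (p - r)) * ∫⁻ t in Ioi 0,
          (∫⁻ s in Ioo 0 t, u s) ^ (r / (p - r)) * u t * φ v w t) ^ ((p - r) / (p * r)) *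
          (∑' k : indexSet M, (c * (∫⁻ t in cell M x k, h t ^ p * v t) ^ (1 / p)) ^ p) ^
            (1 / p) := by gcongr
    _ = _ := by
        simp only [ENNReal.mul_rpow_of_nonneg _ _ hp.le]
        rw [ENNReal.tsum_mul_left, hBφ, ENNReal.mul_rpow_of_nonneg _ _ he.le,
          ENNReal.mul_rpow_of_nonneg (c ^ p) _ (by positivity : 0 ≤ 1 / p), ← ENNReal.rpow_mul c,
          mul_one_div_cancel hp.ne', ENNReal.rpow_one]
        ring

theorem cell_subset_Ioi (M : WithTop ℤ) (x : ℤ → ℝ) (k : ℤ) : cell M x k ⊆ Ioi (x k) :=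
  fun _ ht => ht.1

theorem Ioo_subset_cell {M : WithTop ℤ} {x : ℤ → ℝ} {k : ℤ} :
    ∀ t ∈ cell M x k, Ioo (x k) t ⊆ cell M x k :=
  fun _ ht _ hs => ⟨hs.1, fun hk => hs.2.trans (ht.2 hk)⟩

theorem cellIneq_of_lt {p q : ℝ} (hp : 1 ≤ p) (hq : 0 < q) (hqp : q < p) {v w : ℝ → ℝ≥0∞}
    (hv : IsWeight v) (hw : IsWeight w) {M : WithTop ℤ} {x : ℤ → ℝ} {k : ℤ} (hk : 0 ≤ x k)
    (hfin : innerInt p q v w (x k) ≠ ∞) :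
    CellIneq p q v w M x k (8 * (2 ^ (p / (p - q))) ^ ((p - q) / (p * q)) *
      innerInt p q v w (x k) ^ ((p - q) / (p * q))) := by
  intro h hh
  have hd : 0 < p - q := sub_pos.2 hqp
  have hp0 : 0 < p := by linarith
  have hsub := cell_subset_Ioi M x k
  have hle := lintegral_mono_set (μ := volume) hsub (f := fun t =>
    (∫⁻ s in Ioi t, w s) ^ (q / (p - q)) * w t * sigma p v 0 t ^ (p * q / (p - q)))
  refine (hardy_of_lt hp hq hqp hk hsub Ioo_subset_cell hv hw
    (ne_top_of_le_ne_top hfin hle) hh).trans ?_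
  gcongr
  exact hle

theorem antitone_innerInt (p q : ℝ) (v w : ℝ → ℝ≥0∞) : Antitone (innerInt p q v w) :=
  fun _ _ hst => lintegral_mono_set (Ioi_subset_Ioi hst)

end CopsonHardy

open CopsonHardy

theorem lemma6p1 (p q r : ℝ) (hp : 1 ≤ p) (hq : 0 < q) (hr : 0 < r) :
    (p ≤ min q r → CopsonHardy.Suffices p q r (CopsonHardy.B₁ p q r)) ∧
    (r < p ∧ p ≤ q → CopsonHardy.Suffices p q r (CopsonHardy.B₂ p q r)) ∧
    (q < p ∧ p ≤ r → CopsonHardy.Suffices p q r (CopsonHardy.B₃ p q r)) ∧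
    (max q r < p → CopsonHardy.Suffices p q r (CopsonHardy.B₄ p q r)) := by
  have hp0 : 0 < p := by linarith
  -- `2 ^ (k / r)` is the value of `(∫₀ᵗ u) ^ (1 / r)` at `t = x k`.
  have hU : ∀ {u : ℝ → ℝ≥0∞} {M : WithTop ℤ} {x : ℤ → ℝ}, IsCoveringSequence u M x →
      ∀ k ∈ indexSet M, (2 : ℝ≥0∞) ^ ((k : ℝ) / r) = (∫⁻ s in Ioo 0 (x k), u s) ^ (1 / r) := by
    intro u M x hx k hk
    rw [hx.integral_eq k hk, ← ENNReal.rpow_intCast, ← ENNReal.rpow_mul, mul_one_div]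
  have hpow : ∀ k : ℤ, (2 : ℝ≥0∞) ^ ((k : ℝ) / r) ≠ 0 := fun k =>
    (ENNReal.rpow_pos (by norm_num) (by norm_num)).ne'
  have hpow' : ∀ k : ℤ, (2 : ℝ≥0∞) ^ ((k : ℝ) / r) ≠ ∞ := fun k =>
    ENNReal.rpow_ne_top_of_ne_zero (by norm_num) (by norm_num)
  have hc2 : q < p → (8 * (2 ^ (p / (p - q))) ^ ((p - q) / (p * q)) : ℝ≥0∞) ≠ ∞ := by
    intro hqp
    have hd : 0 < p - q := sub_pos.2 hqp
    exact ENNReal.mul_ne_top (by norm_num) (ENNReal.rpow_ne_top_of_nonneg (by positivity)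
      (ENNReal.rpow_ne_top_of_nonneg (by positivity) (by norm_num)))
  refine ⟨fun h => ?_, fun ⟨hrp, hpq⟩ => ?_, fun ⟨hqp, hpr⟩ => ?_, fun h => ?_⟩
  · obtain ⟨hpq, hpr⟩ := le_min_iff.1 h
    refine .of_cellIneq_of_le hp0 hpr (c := 8) (by norm_num) fun u v w hu hv hw M x hx hB k hk => ?_
    -- This is the largest cell constant that the factor `2 ^ (k / r)` allows.
    refine ⟨B₁ p q r u v w / 2 ^ ((k : ℝ) / r), fun h hh => ?_,
      (ENNReal.mul_div_cancel (hpow k) (hpow' k)).le⟩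
    refine hardy_of_le hp hpq (hx.pos k hk).le (cell_subset_Ioi M x k) Ioo_subset_cell hv hw.meas
      (ENNReal.div_ne_top hB.ne (hpow k)) ?_ hh
    refine ae_restrict_of_forall_mem (measurableSet_of_forall_Ioo_subset (cell_subset_Ioi M x k)
      Ioo_subset_cell) fun t ht => ?_
    rw [ENNReal.le_div_iff_mul_le (Or.inl (hpow k)) (Or.inl (hpow' k)), mul_comm, hU hx k hk,
      ← mul_assoc]
    refine le_trans ?_ (le_iSup₂_of_le t ((hx.pos k hk).trans ht.1) le_rfl)
    gcongr
    exact ht.1.le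
  · have hd : 0 < p - r := sub_pos.2 hrp
    have hs : 0 < p * r / (p - r) := by positivity
    refine .of_cellIneq_of_lt hr hrp (c := 8) (by norm_num)
      (φ := fun v w t => (essSup (fun x => (∫⁻ s in Ioi x, w s) ^ (1 / q) * sigma p v 0 x)
        (volume.restrict (Ioi t))) ^ (p * r / (p - r))) (fun v w s t hst => ?_)
      (fun _ _ _ => rfl) fun v w hv hw M x k hk hxk hfin h hh => ?_
    · exact ENNReal.rpow_le_rpow (essSup_mono_measure
        (Measure.restrict_mono (Ioi_subset_Ioi hst) le_rfl).absolutelyContinuous) hs.le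
    · rw [← ENNReal.rpow_mul, show p * r / (p - r) * ((p - r) / (p * r)) = 1 by field_simp,
        ENNReal.rpow_one]
      refine hardy_of_le hp hpq hxk (cell_subset_Ioi M x k) Ioo_subset_cell hv hw.meas
        (fun h => hfin ?_) ?_ hh
      · rw [h, ENNReal.top_rpow_of_pos hs]
      · exact ae_mono (Measure.restrict_mono (cell_subset_Ioi M x k) le_rfl)
          (ENNReal.ae_le_essSup _)
  · have hd : 0 < p - q := sub_pos.2 hqp
    refine .of_cellIneq_of_le hp0 hpr (hc2 hqp) fun u v w hu hv hw M x hx hB k hk => ?_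
    have hle : (2 : ℝ≥0∞) ^ ((k : ℝ) / r) * innerInt p q v w (x k) ^ ((p - q) / (p * q)) ≤
        B₃ p q r u v w := by
      rw [hU hx k hk]
      exact le_iSup₂_of_le (x k) (hx.pos k hk) le_rfl
    refine ⟨_, cellIneq_of_lt hp hq hqp hv hw (hx.pos k hk).le (fun h => hB.ne ?_), hle⟩
    rw [h, ENNReal.top_rpow_of_pos (by positivity), ENNReal.mul_top (hpow k)] at hle
    exact top_le_iff.1 hle
  · obtain ⟨hqp, hrp⟩ := max_lt_iff.1 h
    have hd : 0 < p - q := sub_pos.2 hqp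
    have hd' : 0 < p - r := sub_pos.2 hrp
    have hs : 0 < r * (p - q) / (q * (p - r)) := by positivity
    refine .of_cellIneq_of_lt hr hrp (hc2 hqp)
      (φ := fun v w t => innerInt p q v w t ^ (r * (p - q) / (q * (p - r))))
      (fun v w s t hst => ENNReal.rpow_le_rpow (antitone_innerInt p q v w hst) hs.le)
      (fun _ _ _ => rfl) fun v w hv hw M x k hk hxk hfin => ?_
    rw [← ENNReal.rpow_mul (innerInt p q v w (x k)),
      show r * (p - q) / (q * (p - r)) * ((p - r) / (p * r)) =
      (p - q) / (p * q) by field_simp]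
    refine cellIneq_of_lt hp hq hqp hv hw hxk fun h => hfin ?_
    rw [h, ENNReal.top_rpow_of_pos hs]
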